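/- Let $\kappa$ be an uncountable cardinal. All groups are abelian; a group $A$ has trivial dual if $\operatorname{Hom}(A,\mathbb Z)=0$. A cardinal $\lambda$ is called $\mathcal L_{\omega_1\omega}$-compact if every $\lambda$-complete (proper) filter on any set $I$ can be extended to an $\omega_1$-complete ultrafilter on $I$. A homogeneous $\mathbb Z$-linear equation in variables from a set $X$ is an equation $\sum_{x\in J}a_x x=0$ with $J\subseteq X$ finite and $a_x\in\mathbb Z\setminus\{0\}$ for $x\in J$; the elements of $J$ are the variables appearing in it. A nonempty system (set) $S$ of such equations has a weakly nontrivial solution in $\mathbb Z$ if there is a map $f:X\to\mathbb Z$ such that $\sum_{x\in J}a_xf(x)=0$ for every equation $\sum_{x\in J}a_xx=0$ in $S$, and $f(x)\neq 0$ for at least one variable $x$ appearing in an equation of $S$; the empty system has, by convention, a weakly nontrivial solution. The following conditions are equivalent: (1) There exists a regular (infinite) cardinal $\lambda\le\kappa$ which is $\mathcal L_{\omega_1\omega}$-compact. (2) There is a regular (infinite) cardinal $\lambda\le\kappa$ such that each group $A$ with trivial dual is the sum of those of its subgroups that have cardinality $<\lambda$ and trivial dual. (3) For every set $X$, every nonempty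 system $S$ of homogeneous $\mathbb Z$-linear equations in variables from $X$ which has no weakly nontrivial solution in $\mathbb Z$, and every $C\subseteq S$ with $|C|<\kappa$, there exists $T$ with $C\subseteq T\subseteq S$ and $|T|<\kappa$ such that $T$ has no weakly nontrivial solution in $\mathbb Z$. -/

import Mathlib

universe u v

/-- The cardinal `κ` is `L_{νω}`-compact: every `κ`-complete proper filter on any set can be
extended to a `ν`-complete ultrafilter. (`CardinalInterFilter F κ` says that `F` is closed under
intersections of fewer than `κ` members; `(U : Filter I) ≤ F` says that every member of `F`
is a member of `U`.) -/
def IsLCompact (ν κ : Cardinal.{u}) : Prop :=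
  ∀ (I : Type u) (F : Filter I), F.NeBot → CardinalInterFilter F κ →
    ∃ U : Ultrafilter I, (U : Filter I) ≤ F ∧ CardinalInterFilter (U : Filter I) ν

/-- The abelian group `A` has trivial `ℤ`-dual, that is, `Hom(A, ℤ) = 0`. -/
def HasTrivialDual (A : Type u) [AddCommGroup A] : Prop :=
  ∀ f : A →+ ℤ, f = 0

/-- A homogeneous `ℤ`-linear equation `∑ aⱼ xⱼ = 0` in variables from `X`, given by its
finitely supported family of coefficients. -/
abbrev HomEquation (X : Type u) : Type u := X →₀ ℤ

/-- The map `f` solves the equation `∑ aⱼ xⱼ = 0` in the abelian group `H`. -/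
def HomEquation.IsSolution {X : Type u} {H : Type v} [AddCommGroup H]
    (e : HomEquation X) (f : X → H) : Prop :=
  ∑ x ∈ e.support, e x • f x = 0

/-- The set of variables that appear in some equation of the system `S`
(with a nonzero coefficient). -/
def appearingVars {X : Type u} (S : Set (HomEquation X)) : Set X :=
  {x | ∃ e ∈ S, x ∈ e.support}

/-- The system `S` is weakly nontrivially solvable in the abelian group `H`: there is a map from
the variables to `H` that solves every equation of `S` and is not constantly zero on the variables
appearing in `S`. By convention, the empty system is weakly nontrivially solvable. -/
def WeaklyNontriviallySolvable {X : Type u} (S : Set (HomEquation X))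
    (H : Type v) [AddCommGroup H] : Prop :=
  S = ∅ ∨ ∃ f : X → H, (∀ e ∈ S, e.IsSolution f) ∧ ∃ x ∈ appearingVars S, f x ≠ 0

/-!
Throughout, "small" means of size less than a regular uncountable cardinal `μ ≤ κ`, and a system is
unsolvable if it has no weakly nontrivial solution in `ℤ`.

*Compactness gives sums of small subgroups.* Let `A` have trivial dual and `a ∈ A`. Some small
`s ⊆ A` is such that every map `A → ℤ` additive on `s` kills `a`: otherwise choose a counterexample
for each small `s` and take their limit along an `ω₁`-complete ultrafilter on the small subsets that
is fine, that is, contains `{s | x ∈ s}` for all `x`. The limit exists since `ℤ` is countable, and it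
is a homomorphism `A → ℤ` that does not kill `a` (`HasTrivialDual.exists_forcesKernel`). Closing `{a}`
under such sets `s` and passing to the generated subgroup gives a small subgroup with trivial dual
that contains `a` (`IsLCompact.sSup_small_trivialDual`).

*Sums of small subgroups give small subsystems.* An unsolvable system presents a group with trivial
dual. If a variable `x` is sent into a small subgroup with trivial dual, then the equations needed to
derive the addition table of that subgroup already force `x` to be zero
(`exists_small_forcesZero`), and it remains to close `C` under adding these equations
(`exists_small_not_solvable`). If the bound on the subgroups is less than `κ`, it is first enlarged
to a successor cardinal `μ ≤ κ` greater than `#C`.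

*Small subsystems give ultrafilters.* If `κ` is singular, a uniform bound `μ < κ` works for
subsystems containing a single given equation: otherwise the disjoint union of counterexamples for
`cof κ` many bounds, with `C` a choice of one equation from each, contradicts the hypothesis
(`exists_lt_locallyReflects`). Given a `μ`-complete filter `F` on `I`, consider the equations between
functions `I → ℤ` that hold modulo `F`. Every subsystem of fewer than `μ` equations is solved by
evaluation at some point of `I`, so the whole system has a nontrivial solution, which is a nonzero
homomorphism `φ : ℤ^I → ℤ` that kills the functions vanishing modulo `F`
(`LocallyReflects.isLCompact`). By a theorem of Łoś, `φ` yields an `ω₁`-complete ultrafilter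
(`exists_ultrafilter_of_hom`): the sets `J ⊆ I` such that `φ` kills all functions supported in `J`
form a `σ`-ideal by Specker's theorem that a homomorphism `ℤ^ℕ → ℤ` killing the unit vectors is
zero, and, `ℤ` being slender, there is no infinite family of disjoint sets outside this ideal, so
there is an atom. The ultrafilter lives on the atom, and it extends `F` because complements of
members of `F` are in the ideal.
-/

open Cardinal Filter

/-! ### Homomorphisms from `ℤ^ℕ` to `ℤ` -/

/-- A homomorphism `ℤ^ℕ → ℤ` that kills the unit vectors kills all finitely supported vectors, so
it sends a sequence whose terms are divisible by `d` from some point on to a multiple of `d`. -/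
lemma dvd_map_of_eventually_dvd (φ : (ℕ → ℤ) →+ ℤ) (k : ℕ) (d : ℤ)
    (hφ : ∀ n < k, φ (Pi.single n 1) = 0) (a : ℕ → ℤ) (ha : ∀ n, k ≤ n → d ∣ a n) :
    d ∣ φ a := by
  induction k generalizing a with
  | zero =>
    choose b hb using fun n => ha n (Nat.zero_le n)
    have : a = d • b := by ext n; simp [hb n]
    rw [this, map_zsmul]
    exact ⟨φ b, smul_eq_mul _ _⟩
  | succ k ih =>
    have h := ih (fun n hn => hφ n (by omega)) (a - a k • Pi.single k 1) (by
      intro n hn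
      rcases hn.eq_or_lt with rfl | hn
      · simp
      · have : n ≠ k := by omega
        simpa [Pi.single_apply, this] using ha n hn)
    rwa [map_sub, map_zsmul, hφ k (by omega), smul_zero, sub_zero] at h

lemma eq_zero_of_forall_pow_dvd {p : ℤ} (hp : 1 < p) {z : ℤ} (h : ∀ k : ℕ, p ^ k ∣ z) : z = 0 := by
  by_contra hz
  obtain ⟨n, hn⟩ := (Int.finiteMultiplicity_iff (a := p) (b := z)).2 ⟨by omega, hz⟩
  exact hn (h (n + 1))

/-- Every sequence is `∑ 2ⁿ bₙ eₙ + ∑ 3ⁿ cₙ eₙ`, and the values at the two summands are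
divisible by all powers of `2`, respectively `3`. -/
lemma map_eq_zero_of_forall_single (φ : (ℕ → ℤ) →+ ℤ) (hφ : ∀ n, φ (Pi.single n 1) = 0)
    (a : ℕ → ℤ) : φ a = 0 := by
  have key : ∀ p : ℤ, 1 < p → ∀ b : ℕ → ℤ, φ (fun n => p ^ n * b n) = 0 := fun p hp b =>
    eq_zero_of_forall_pow_dvd hp fun k =>
      dvd_map_of_eventually_dvd φ k _ (fun n _ => hφ n) _ fun n hn =>
        (pow_dvd_pow p hn).mul_right _
  have hc : ∀ n : ℕ, IsCoprime ((2 : ℤ) ^ n) (3 ^ n) := fun n =>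
    IsCoprime.pow (by rw [Int.isCoprime_iff_gcd_eq_one]; rfl)
  choose x y hxy using hc
  have : a = (fun n => 2 ^ n * (x n * a n)) + fun n => 3 ^ n * (y n * a n) := by
    ext n
    simp only [Pi.add_apply]
    linear_combination (-a n) * hxy n
  rw [this, map_add, key 2 (by norm_num), key 3 (by norm_num), add_zero]

/-- The group `ℤ` is slender: a homomorphism `ℤ^ℕ → ℤ` cannot be nonzero at every unit vector. -/
lemma exists_map_single_eq_zero (φ : (ℕ → ℤ) →+ ℤ) : ∃ n, φ (Pi.single n 1) = 0 := by
  by_contra! hφ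
  -- Weights `d n` with `d (n + 1) = d n * (2 * φ eₙ)`: two of the uncountably many sums
  -- `∑ εₙ dₙ eₙ` with `εₙ ∈ {0, 1}` have the same image, which is impossible modulo `d (k + 1)`
  -- for the first `k` at which they differ.
  let d : ℕ → ℤ := fun n => ∏ i ∈ Finset.range n, (2 * φ (Pi.single i 1))
  have hd0 : ∀ n, d n ≠ 0 := fun n => Finset.prod_ne_zero_iff.2 fun i _ => by simp [hφ i]
  have hdvd : ∀ m n, m ≤ n → d m ∣ d n := fun m n h =>
    Finset.prod_dvd_prod_of_subset _ _ _ (Finset.range_mono h)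
  let s : Set ℕ → ℕ → ℤ := fun E n => d n * E.indicator 1 n
  have hninj : ¬ Function.Injective fun E => φ (s E) := fun h =>
    Function.cantor_injective _ (Encodable.encode_injective.comp h)
  simp only [Function.Injective, not_forall] at hninj
  obtain ⟨E, F, hEF, hne⟩ := hninj
  classical
  have hex : ∃ n, ¬ (n ∈ E ↔ n ∈ F) := by
    by_contra! h
    exact hne (Set.ext h)
  set k := Nat.find hex with hk
  have hkk : ¬ (k ∈ E ↔ k ∈ F) := Nat.find_spec hex
  have hlt : ∀ n < k, (n ∈ E ↔ n ∈ F) := fun n hn => not_not.1 (Nat.find_min hex hn)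
  let t : ℕ → ℤ := s E - s F
  have ht0 : φ t = 0 := by simp [t, hEF]
  have htlt : ∀ n < k, t n = 0 := fun n hn => by
    simp [t, s, Set.indicator_apply, hlt n hn]
  have htk : t k = d k ∨ t k = -d k := by
    by_cases h1 : k ∈ E <;> by_cases h2 : k ∈ F <;> simp_all [t, s, Set.indicator_apply]
  have htail : d (k + 1) ∣ φ (t - t k • Pi.single k 1) := by
    refine dvd_map_of_eventually_dvd φ 0 _ (by simp) _ fun n _ => ?_
    rcases lt_trichotomy n k with h | rfl | h
    · simp [htlt n h, h.ne]
    · simp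
    · have : d (k + 1) ∣ t n := by
        simp only [t, s, Pi.sub_apply, ← mul_sub]
        exact (hdvd _ _ h).mul_right _
      simpa [Pi.single_apply, h.ne'] using this
  have h2 : d k * (2 * φ (Pi.single k 1)) ∣ d k * φ (Pi.single k 1) := by
    have e : d (k + 1) = d k * (2 * φ (Pi.single k 1)) := Finset.prod_range_succ _ _
    rw [← e]
    rw [map_sub, map_zsmul, ht0, zero_sub, dvd_neg, smul_eq_mul] at htail
    rcases htk with h | h <;> rw [h] at htail
    · exact htail
    · simpa using htail
  have h3 := (mul_dvd_mul_iff_left (hd0 k)).1 h2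
  obtain ⟨c, hc⟩ := h3
  have : 2 * c = 1 := mul_left_cancel₀ (hφ k) (by linear_combination -hc)
  omega

/-! ### Homomorphisms from `ℤ^I` to `ℤ` and countably complete ultrafilters -/

section Product

variable {I : Type u}

/-- The set `J` is null for `φ : ℤ^I → ℤ` if `φ` kills every function that vanishes off `J`. -/
def IsNullSet (φ : (I → ℤ) →+ ℤ) (J : Set I) : Prop :=
  ∀ f : I → ℤ, (∀ i ∉ J, f i = 0) → φ f = 0

/-- Multiplication of `f` by the sequence `a`, read along the partition of `I` given by `N`. -/
def blockMul (N : I → ℕ) (f : I → ℤ) : (ℕ → ℤ) →+ (I → ℤ) where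
  toFun a i := a (N i) * f i
  map_zero' := by ext; simp
  map_add' a b := by ext; simp [add_mul]

lemma blockMul_one (N : I → ℕ) (f : I → ℤ) : blockMul N f 1 = f := by
  ext; simp [blockMul]

lemma blockMul_single (N : I → ℕ) (f : I → ℤ) (n : ℕ) :
    blockMul N f (Pi.single n 1) = {i | N i = n}.indicator f := by
  ext i
  by_cases h : N i = n <;> simp [blockMul, h]

variable {φ : (I → ℤ) →+ ℤ}

lemma IsNullSet.mono {J K : Set I} (hK : IsNullSet φ K) (h : J ⊆ K) : IsNullSet φ J :=
  fun f hf => hK f fun i hi => hf i fun hJ => hi (h hJ)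

lemma isNullSet_empty : IsNullSet φ (∅ : Set I) := fun f hf => by
  have : f = 0 := by ext i; exact hf i (by simp)
  simp [this]

lemma IsNullSet.iUnion {K : ℕ → Set I} (hK : ∀ n, IsNullSet φ (K n)) :
    IsNullSet φ (⋃ n, K n) := by
  classical
  intro f hf
  let N : I → ℕ := fun i => if h : ∃ n, i ∈ K n then Nat.find h else 0
  have hN : ∀ i, f i ≠ 0 → i ∈ K (N i) := by
    intro i hi
    have h : ∃ n, i ∈ K n := by
      by_contra hcon
      exact hi (hf i (by simpa using hcon))
    simp only [N, dif_pos h]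
    exact Nat.find_spec h
  have h := map_eq_zero_of_forall_single (φ.comp (blockMul N f)) (fun n => ?_) 1
  · simpa [blockMul_one] using h
  · rw [AddMonoidHom.comp_apply, blockMul_single]
    refine hK n _ fun i hi => ?_
    by_contra hne
    obtain ⟨h1, h2⟩ := Set.indicator_apply_ne_zero.1 hne
    exact hi (h1 ▸ hN i h2)

lemma IsNullSet.sUnion {𝒮 : Set (Set I)} (hc : 𝒮.Countable) (h : ∀ K ∈ 𝒮, IsNullSet φ K) :
    IsNullSet φ (⋃₀ 𝒮) := by
  rcases 𝒮.eq_empty_or_nonempty with rfl | hne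
  · simpa using isNullSet_empty
  · obtain ⟨K, rfl⟩ := hc.exists_eq_range hne
    rw [Set.sUnion_range]
    exact IsNullSet.iUnion fun n => h _ ⟨n, rfl⟩

lemma IsNullSet.union {J K : Set I} (hJ : IsNullSet φ J) (hK : IsNullSet φ K) :
    IsNullSet φ (J ∪ K) := by
  rw [← Set.sUnion_pair]
  exact IsNullSet.sUnion (Set.to_countable _) (by simp [hJ, hK])

/-- Glue witnesses on the `D n` to a single function and use that `ℤ` is slender. -/
lemma exists_isNullSet_of_pairwise_disjoint {D : ℕ → Set I}
    (hD : ∀ m n i, i ∈ D m → i ∈ D n → m = n) : ∃ n, IsNullSet φ (D n) := by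
  classical
  by_contra! hcon
  simp only [IsNullSet, not_forall] at hcon
  choose f hf hφ using hcon
  let N : I → ℕ := fun i => if h : ∃ n, i ∈ D n then h.choose else 0
  have hN : ∀ n i, i ∈ D n → N i = n := fun n i hi => by
    have h : ∃ n, i ∈ D n := ⟨n, hi⟩
    simp only [N, dif_pos h]
    exact hD _ _ i h.choose_spec hi
  obtain ⟨n, hn⟩ := exists_map_single_eq_zero (φ.comp (blockMul N fun i => f (N i) i))
  rw [AddMonoidHom.comp_apply, blockMul_single] at hn
  refine hφ n (Eq.trans (congrArg φ ?_) hn)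
  ext i
  by_cases h : N i = n
  · simp [h]
  · have : i ∉ D n := fun hi => h (hN n i hi)
    simp [h, hf n i this]

/-- Otherwise, splitting again and again would produce infinitely many disjoint sets that are
not null. -/
lemma exists_not_isNullSet_atom (hφ : φ ≠ 0) :
    ∃ J, ¬ IsNullSet φ J ∧ ∀ K ⊆ J, IsNullSet φ K ∨ IsNullSet φ (J \ K) := by
  by_contra! hcon
  have huniv : ¬ IsNullSet φ Set.univ := fun h => hφ (by ext1 f; exact h f (by simp))
  choose! s hsub hs hs' using hcon
  let J : ℕ → Set I := fun n => s^[n] Set.univ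
  have hJsucc : ∀ n, J (n + 1) = s (J n) := fun n => Function.iterate_succ_apply' s n _
  have hJ : ∀ n, ¬ IsNullSet φ (J n) := by
    intro n
    induction n with
    | zero => exact huniv
    | succ n ih => rw [hJsucc]; exact hs _ ih
  have hanti : Antitone J := antitone_nat_of_succ_le fun n => by
    rw [hJsucc]; exact hsub _ (hJ n)
  have hlt : ∀ m n i, m < n → i ∈ J m \ J (m + 1) → i ∈ J n \ J (n + 1) → False :=
    fun m n i h hm hn => hm.2 (hanti h hn.1)
  obtain ⟨n, hn⟩ := exists_isNullSet_of_pairwise_disjoint (φ := φ)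
    (D := fun n => J n \ J (n + 1)) (fun m n i hm hn => by
      rcases lt_trichotomy m n with h | h | h
      · exact (hlt _ _ _ h hm hn).elim
      · exact h
      · exact (hlt _ _ _ h hn hm).elim)
  rw [hJsucc] at hn
  exact hs' _ (hJ n) hn

/-- A nonzero homomorphism `ℤ^I → ℤ` that is well defined modulo a filter `F` yields a countably
complete ultrafilter extending `F`: the sets whose complement is null inside an atom. -/
theorem exists_ultrafilter_of_hom (F : Filter I) (hφ : φ ≠ 0)
    (hF : ∀ f : I → ℤ, (∀ᶠ i in F, f i = 0) → φ f = 0) :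
    ∃ U : Ultrafilter I, (U : Filter I) ≤ F ∧ CountableInterFilter (U : Filter I) := by
  obtain ⟨J, hJ, hatom⟩ := exists_not_isNullSet_atom hφ
  let G : Filter I := Filter.ofCountableUnion {K | IsNullSet φ (J ∩ K)}
    (fun S hc hS => by
      have h := IsNullSet.sUnion (φ := φ) (hc.image (J ∩ ·))
        (by rintro _ ⟨K, hK, rfl⟩; exact hS K hK)
      exact h.mono (by rintro i ⟨hi, K, hK, hiK⟩; exact ⟨_, ⟨K, hK, rfl⟩, hi, hiK⟩))
    (fun t ht s hs => IsNullSet.mono ht (Set.inter_subset_inter_right _ hs))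
  have hG : ∀ K, K ∈ G ↔ IsNullSet φ (J ∩ Kᶜ) := fun K => Iff.rfl
  refine ⟨Ultrafilter.ofComplNotMemIff G fun K => ?_, fun K hK => ?_, ?_⟩
  · rw [hG, hG, compl_compl]
    constructor
    · intro h
      have := (hatom (J ∩ K) Set.inter_subset_left).resolve_left h
      rwa [Set.sdiff_self_inter] at this
    · intro h h'
      exact hJ (by simpa [Set.inter_union_compl] using h'.union h)
  · refine (hG K).2 fun f hf => hF f ?_
    filter_upwards [hK] with i hi
    exact hf i fun h => h.2 hi
  · change CountableInterFilter G
    dsimp only [G]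
    infer_instance

end Product

/-! ### Solutions of systems of equations -/

section Equations

variable {X : Type u}

lemma HomEquation.isSolution_iff {e : HomEquation X} {f : X → ℤ} :
    e.IsSolution f ↔ Finsupp.linearCombination ℤ f e = 0 := Iff.rfl

/-- Every solution of `T` vanishes at the variable `x`. -/
def ForcesZero (T : Set (HomEquation X)) (x : X) : Prop :=
  ∀ f : X → ℤ, (∀ e ∈ T, e.IsSolution f) → f x = 0

lemma ForcesZero.mono {T T' : Set (HomEquation X)} {x : X} (h : ForcesZero T x) (hT : T ⊆ T') :
    ForcesZero T' x :=
  fun f hf => h f fun e he => hf e (hT he)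

lemma not_weaklyNontriviallySolvable_iff {S : Set (HomEquation X)} :
    ¬ WeaklyNontriviallySolvable S ℤ ↔ S.Nonempty ∧ ∀ x ∈ appearingVars S, ForcesZero S x := by
  unfold WeaklyNontriviallySolvable ForcesZero
  rw [not_or, Set.nonempty_iff_ne_empty]
  push Not
  refine and_congr Iff.rfl ⟨fun h x hx f hf => h f hf x hx, fun h f hf x hx => h x hx f hf⟩

/-- Each equation of an unsolvable system lies in an unsolvable subsystem with fewer than `μ`
equations. -/
def LocallyReflects (μ : Cardinal.{u}) : Prop :=
  ∀ (X : Type u) (S : Set (HomEquation X)), ¬ WeaklyNontriviallySolvable S ℤ → ∀ e ∈ S,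
    ∃ T ⊆ S, e ∈ T ∧ #T < μ ∧ ¬ WeaklyNontriviallySolvable T ℤ

lemma LocallyReflects.mono {μ ν : Cardinal.{u}} (h : LocallyReflects μ) (hμν : μ ≤ ν) :
    LocallyReflects ν := fun X S hS e he =>
  let ⟨T, hT, heT, hc, hn⟩ := h X S hS e he
  ⟨T, hT, heT, hc.trans_le hμν, hn⟩

end Equations

/-! ### From reflection to ultrafilters -/

/-- The system of all equations between integer-valued functions on `I` that hold modulo `F`
has, as its solutions, the homomorphisms `ℤ^I → ℤ` that are well defined modulo `F`. A small
subsystem is solved by evaluation at a suitable point of `I`. -/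
theorem LocallyReflects.isLCompact {μ : Cardinal.{u}} (h : LocallyReflects μ) :
    IsLCompact ℵ₁ μ := by
  intro I F hne hF
  simp only [cardinalInterFilter_aleph_one_iff]
  let S : Set (HomEquation (I → ℤ)) := {e | ∀ᶠ i in F, e.IsSolution fun f : I → ℤ => f i}
  have hmem : ∀ e : HomEquation (I → ℤ),
      e ∈ S ↔ ∀ᶠ i in F, Finsupp.linearCombination ℤ (fun f : I → ℤ => f i) e = 0 :=
    fun e => Iff.rfl
  obtain ⟨i₀⟩ : Nonempty I := hne.nonempty
  let e₀ : HomEquation (I → ℤ) := Finsupp.single 2 1 - Finsupp.single 1 2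
  have he₀ : e₀ ∈ S := (hmem _).2 (Eventually.of_forall fun i => by simp [e₀])
  have h1 : (1 : I → ℤ) ∈ e₀.support := by
    have : (2 : I → ℤ) ≠ 1 := fun h => by simpa using congrFun h i₀
    simp [e₀, this]
  have hS : WeaklyNontriviallySolvable S ℤ := by
    by_contra hS
    obtain ⟨T, hTS, heT, hc, hT⟩ := h _ S hS e₀ he₀
    have hall : ∀ᶠ i in F, ∀ e ∈ T, e.IsSolution fun f : I → ℤ => f i :=
      (eventually_cardinal_ball hc).2 fun e he => hTS he
    obtain ⟨i, hi⟩ := hall.exists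
    exact one_ne_zero ((not_weaklyNontriviallySolvable_iff.1 hT).2 1 ⟨e₀, heT, h1⟩ _ hi)
  obtain hS | ⟨φ, hφ, f, -, hf⟩ := hS
  · simp [hS] at he₀
  let Φ : (I → ℤ) →+ ℤ := AddMonoidHom.mk' φ fun a b => by
    have : Finsupp.single (a + b) 1 - Finsupp.single a 1 - Finsupp.single b 1 ∈ S :=
      (hmem _).2 (Eventually.of_forall fun i => by simp)
    have := HomEquation.isSolution_iff.1 (hφ _ this)
    simp only [map_sub, Finsupp.linearCombination_single, one_smul] at this
    linarith
  refine exists_ultrafilter_of_hom (φ := Φ) F (fun h => hf (DFunLike.congr_fun h f)) fun g hg => ?_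
  have : Finsupp.single g 1 ∈ S := (hmem _).2 (by simpa using hg)
  have hφg : φ g = 0 := by simpa [HomEquation.isSolution_iff] using hφ _ this
  exact hφg

/-! ### Bounding the size of subsystems below a singular cardinal -/

/-- Cofinality, for a singular cardinal, in terms of a family of cardinals. -/
lemma Cardinal.IsSingular.exists_unbounded_family {κ : Cardinal.{u}} (hκ : κ.IsSingular) :
    ∃ (ι : Type u) (f : ι → Cardinal.{u}), #ι < κ ∧ (∀ i, f i < κ) ∧ ∀ ν < κ, ∃ i, ν < f i := by
  obtain ⟨s, hs, hcard⟩ := Order.exists_cof_eq κ.ord.ToType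
  refine ⟨s, fun i => #(Set.Iio i.1), ?_, fun i => ?_, fun ν hν => ?_⟩
  · rw [hcard, Ordinal.cof_toType]
    exact hκ.cof_ord_lt
  · simpa using mk_Iio_lt i.1 (by simp)
  · have hlt : (Order.succ ν).ord < Ordinal.type (α := κ.ord.ToType) (· < ·) := by
      rw [Ordinal.type_toType, ord_lt_ord]
      exact hκ.isSuccLimit.succ_lt hν
    obtain ⟨i, hi, hle⟩ := hs (Ordinal.enum (α := κ.ord.ToType) (· < ·) ⟨_, hlt⟩)
    refine ⟨⟨i, hi⟩, (Order.lt_succ ν).trans_le ?_⟩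
    rw [← card_ord (Order.succ ν), ← Ordinal.typein_enum (α := κ.ord.ToType) (· < ·) hlt]
    exact (Ordinal.card_typein _).symm.trans_le (mk_le_mk_of_subset (Set.Iio_subset_Iio hle))

/-- The disjoint union of a family of systems, in the disjoint union of their variable sets. -/
def sigmaSystem {ι : Type u} {X : ι → Type u} (S : ∀ i, Set (HomEquation (X i))) :
    Set (HomEquation (Σ i, X i)) :=
  ⋃ i, Finsupp.mapDomain (Sigma.mk i) '' S i

section Sigma

variable {ι : Type u} {X : ι → Type u} {S : ∀ i, Set (HomEquation (X i))}

lemma isSolution_mapDomain_sigmaMk {i : ι} {e : HomEquation (X i)} {f : (Σ i, X i) → ℤ} :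
    HomEquation.IsSolution (Finsupp.mapDomain (Sigma.mk i) e) f ↔
      e.IsSolution fun x => f ⟨i, x⟩ := by
  rw [HomEquation.isSolution_iff, HomEquation.isSolution_iff, Finsupp.linearCombination_mapDomain]
  rfl

lemma mem_support_mapDomain_sigmaMk {i : ι} {e : HomEquation (X i)} {y : Σ i, X i} :
    y ∈ (Finsupp.mapDomain (Sigma.mk i) e).support ↔ ∃ x ∈ e.support, y = ⟨i, x⟩ := by
  classical
  rw [Finsupp.mapDomain_support_of_injective sigma_mk_injective]
  simp [eq_comm]

lemma not_weaklyNontriviallySolvable_sigmaSystem [Nonempty ι]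
    (hS : ∀ i, ¬ WeaklyNontriviallySolvable (S i) ℤ) :
    ¬ WeaklyNontriviallySolvable (sigmaSystem S) ℤ := by
  simp only [not_weaklyNontriviallySolvable_iff] at hS ⊢
  constructor
  · obtain ⟨i⟩ := ‹Nonempty ι›
    obtain ⟨e, he⟩ := (hS i).1
    exact ⟨_, Set.mem_iUnion.2 ⟨i, e, he, rfl⟩⟩
  · rintro y ⟨_, he', hy⟩ f hf
    obtain ⟨i, e, he, rfl⟩ := Set.mem_iUnion.1 he'
    obtain ⟨x, hx, rfl⟩ := mem_support_mapDomain_sigmaMk.1 hy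
    exact (hS i).2 x ⟨e, he, hx⟩ (fun x => f ⟨i, x⟩) fun e he =>
      isSolution_mapDomain_sigmaMk.1 (hf _ (Set.mem_iUnion.2 ⟨i, e, he, rfl⟩))

/-- A solution of one component, extended by zero, is a solution of the whole. -/
lemma not_weaklyNontriviallySolvable_component {T : Set (HomEquation (Σ i, X i))}
    (hT : T ⊆ sigmaSystem S) (hn : ¬ WeaklyNontriviallySolvable T ℤ) (i : ι)
    (hne : (S i ∩ Finsupp.mapDomain (Sigma.mk i) ⁻¹' T).Nonempty) :
    ¬ WeaklyNontriviallySolvable (S i ∩ Finsupp.mapDomain (Sigma.mk i) ⁻¹' T) ℤ := by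
  classical
  rw [not_weaklyNontriviallySolvable_iff] at hn ⊢
  refine ⟨hne, ?_⟩
  rintro x ⟨e, ⟨heS, heT⟩, hx⟩ f hf
  let g : (Σ i, X i) → ℤ := fun y => if h : y.1 = i then f (h ▸ y.2) else 0
  have hgi : (fun x => g ⟨i, x⟩) = f := by ext; simp [g]
  have hgj : ∀ j, j ≠ i → (fun x => g ⟨j, x⟩) = 0 := fun j hj => by ext; simp [g, hj]
  have hg := hn.2 ⟨i, x⟩ ⟨_, heT, mem_support_mapDomain_sigmaMk.2 ⟨x, hx, rfl⟩⟩ g fun t ht => by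
    obtain ⟨j, e', he', rfl⟩ := Set.mem_iUnion.1 (hT ht)
    rw [isSolution_mapDomain_sigmaMk]
    rcases eq_or_ne j i with rfl | hj
    · rw [hgi]
      exact hf e' ⟨he', ht⟩
    · rw [hgj j hj]
      simp [HomEquation.IsSolution]
  exact (congrFun hgi x).symm.trans hg

end Sigma

/-- Given a counterexample for each of a family of bounds that is unbounded in `κ`, reflection below
`κ` fails for their disjoint union and for `C` consisting of one chosen equation from each. -/
theorem exists_lt_locallyReflects {κ : Cardinal.{u}} (hκ : κ.IsSingular)
    (h : ∀ (X : Type u) (S : Set (HomEquation X)), S.Nonempty →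
        ¬ WeaklyNontriviallySolvable S ℤ →
        ∀ C ⊆ S, #C < κ →
          ∃ T ⊆ S, C ⊆ T ∧ #T < κ ∧ ¬ WeaklyNontriviallySolvable T ℤ) :
    ∃ μ < κ, LocallyReflects μ := by
  by_contra! hcon
  obtain ⟨ι, b, hι, hb, hunb⟩ := hκ.exists_unbounded_family
  have hι0 : Nonempty ι := ⟨(hunb 0 hκ.pos).choose⟩
  have hex := fun i => hcon (b i) (hb i)
  simp only [LocallyReflects, not_forall] at hex
  choose X S hS e he hfail using hex
  let E : ι → HomEquation (Σ i, X i) := fun i => Finsupp.mapDomain (Sigma.mk i) (e i)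
  have hES : Set.range E ⊆ sigmaSystem S := by
    rintro _ ⟨i, rfl⟩
    exact Set.mem_iUnion.2 ⟨i, e i, he i, rfl⟩
  have hns := not_weaklyNontriviallySolvable_sigmaSystem hS
  obtain ⟨T, hTS, hET, hTc, hT⟩ := h _ (sigmaSystem S) (not_weaklyNontriviallySolvable_iff.1 hns).1
    hns (Set.range E) hES (mk_range_le.trans_lt hι)
  obtain ⟨i, hi⟩ := hunb _ hTc
  have hei : e i ∈ S i ∩ Finsupp.mapDomain (Sigma.mk i) ⁻¹' T := ⟨he i, hET ⟨i, rfl⟩⟩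
  refine hfail i ⟨_, Set.inter_subset_left, hei, lt_of_le_of_lt ?_ hi,
    not_weaklyNontriviallySolvable_component hTS hT i ⟨_, hei⟩⟩
  refine (mk_le_mk_of_subset Set.inter_subset_right).trans ?_
  exact mk_preimage_of_injective _ _ (Finsupp.mapDomain_injective sigma_mk_injective)

/-! ### Small sets -/

/-- For a regular `μ > ℵ₀`, every set with fewer than `μ` elements lies in one that is closed under
a given assignment of small sets to points. -/
lemma exists_small_closed {α : Type u} {μ : Cardinal.{u}} (hμ : μ.IsRegular) (hμ' : ℵ₀ < μ)
    (t : α → Set α) (ht : ∀ a, #(t a) < μ) (C : Set α) (hC : #C < μ) :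
    ∃ s, C ⊆ s ∧ #s < μ ∧ ∀ a ∈ s, t a ⊆ s := by
  let c : ℕ → Set α := fun n => (fun s => s ∪ ⋃ a ∈ s, t a)^[n] C
  have hcs : ∀ n, c (n + 1) = c n ∪ ⋃ a ∈ c n, t a := fun n => Function.iterate_succ_apply' _ n C
  have hcard : ∀ n, #(c n) < μ := by
    intro n
    induction n with
    | zero => exact hC
    | succ n ih =>
      rw [hcs]
      exact (mk_union_le _ _).trans_lt (add_lt_of_lt hμ.aleph0_le ih
        ((card_biUnion_lt_iff_forall_of_isRegular hμ ih).2 fun a _ => ht a))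
  refine ⟨⋃ n, c n, Set.subset_iUnion c 0, ?_, fun a ha => ?_⟩
  · have := (card_iUnion_lt_iff_forall_of_isRegular (t := fun n : ULift.{u} ℕ => c n.down) hμ
      (by simpa using hμ')).2 fun n => hcard _
    have e : ⋃ n : ULift.{u} ℕ, c n.down = ⋃ n, c n := Equiv.ulift.surjective.iUnion_comp c
    rwa [e] at this
  · obtain ⟨n, hn⟩ := Set.mem_iUnion.1 ha
    refine subset_trans ?_ (Set.subset_iUnion c (n + 1))
    rw [hcs]
    exact (Set.subset_biUnion_of_mem (u := t) hn).trans Set.subset_union_right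

lemma mk_closure_lt {A : Type u} [AddCommGroup A] {μ : Cardinal.{u}} (hμ : ℵ₀ < μ) {s : Set A}
    (hs : #s < μ) : #(AddSubgroup.closure s) < μ := by
  have hle : #(AddSubgroup.closure s) ≤ #(s →₀ ℤ) := by
    have h := Finsupp.range_linearCombination ℤ (v := ((↑) : s → A))
    rw [Subtype.range_coe] at h
    rw [← Submodule.span_int_eq_addSubgroupClosure, ← h]
    exact mk_range_le (f := Finsupp.linearCombination ℤ ((↑) : s → A))
  refine hle.trans_lt ?_
  rcases isEmpty_or_nonempty s with h | h
  · exact mk_lt_aleph0.trans hμ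
  · simpa using ⟨hs, hμ⟩

/-! ### Groups with trivial dual -/

section Groups

variable {A : Type u} [AddCommGroup A]

/-- Every map `A → ℤ` that is additive on `s` vanishes at `a`. Additivity is required only for sums
that stay inside `s`, so that `s` need not be a subgroup. -/
def ForcesKernel (s : Set A) (a : A) : Prop :=
  ∀ f : A → ℤ, (∀ x ∈ s, ∀ y ∈ s, x + y ∈ s → f (x + y) = f x + f y) → f a = 0

/-- The filter on the sets with fewer than `μ` elements, generated by the cones
`{s | t ⊆ s}`. -/
def coneFilter (A : Type u) {μ : Cardinal.{u}} (hμ : μ.IsRegular) :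
    Filter {s : Set A // #s < μ} :=
  .ofCardinalInter {W | ∃ t : Set A, #t < μ ∧ ∀ s : {s : Set A // #s < μ}, t ⊆ s.1 → s ∈ W}
    (hμ.nat_lt 2)
    (fun S hS h => by
      have h' : ∀ W ∈ S, ∃ t : Set A, #t < μ ∧
          ∀ s : {s : Set A // #s < μ}, t ⊆ s.1 → s ∈ W := fun W hW => h hW
      choose! t ht hts using h'
      refine ⟨⋃ W ∈ S, t W, ?_, fun s hs W hW => hts W hW s ?_⟩
      · exact (card_biUnion_lt_iff_forall_of_isRegular hμ hS).2 ht
      · exact (Set.subset_biUnion_of_mem (u := fun W => t W) hW).trans hs)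
    (fun W W' ⟨t, ht, h⟩ hW => ⟨t, ht, fun s hs => hW (h s hs)⟩)

lemma exists_fine_ultrafilter (A : Type u) {μ : Cardinal.{u}} (hμ : μ.IsRegular)
    (h : IsLCompact ℵ₁ μ) :
    ∃ U : Ultrafilter {s : Set A // #s < μ},
      CountableInterFilter (U : Filter {s : Set A // #s < μ}) ∧
        ∀ a, ∀ᶠ s : {s : Set A // #s < μ} in U, a ∈ s.1 := by
  obtain ⟨U, hU, hc⟩ := h {s : Set A // #s < μ} (coneFilter A hμ)
    ⟨fun hbot => by
      obtain ⟨t, ht, hts⟩ := (hbot ▸ mem_bot : ∅ ∈ coneFilter A hμ)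
      exact hts ⟨t, ht⟩ subset_rfl⟩
    (cardinalInter_ofCardinalInter _ _ _ _)
  exact ⟨U, cardinalInterFilter_aleph_one_iff.1 hc, fun a => hU
    ⟨{a}, by simpa using hμ.nat_lt 1, fun s hs => hs rfl⟩⟩

/-- A function with countable range is constant on a set in a countably complete ultrafilter. -/
lemma exists_eventually_eq_of_countable {I : Type u} {Z : Type*} [Countable Z] (U : Ultrafilter I)
    [CountableInterFilter (U : Filter I)] (f : I → Z) : ∃ z, ∀ᶠ i in (U : Filter I), f i = z := by
  by_contra! h
  have : ∀ᶠ i in (U : Filter I), ∀ z, f i ≠ z :=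
    eventually_countable_forall.2 h
  obtain ⟨i, hi⟩ := this.exists
  exact hi _ rfl

/-- If no small set forces `a` into the kernel, the ultraproduct of partial counterexamples along a
fine ultrafilter is a homomorphism `A → ℤ` that does not vanish at `a`. -/
lemma HasTrivialDual.exists_forcesKernel (hA : HasTrivialDual A) {μ : Cardinal.{u}}
    (hμ : μ.IsRegular) (h : IsLCompact ℵ₁ μ) (a : A) : ∃ s : Set A, #s < μ ∧ ForcesKernel s a := by
  by_contra! hcon
  simp only [ForcesKernel, not_forall] at hcon
  choose f hadd hf using hcon
  obtain ⟨U, hU, hfine⟩ := exists_fine_ultrafilter A hμ h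
  choose g hg using fun x => exists_eventually_eq_of_countable U fun s => f s.1 s.2 x
  let G : A →+ ℤ := AddMonoidHom.mk' g fun x y => by
    obtain ⟨s, hx, hy, hxy, h1, h2, h3⟩ := ((hfine x).and <| (hfine y).and <|
      (hfine (x + y)).and <| (hg x).and <| (hg y).and (hg (x + y))).exists
    rw [← h1, ← h2, ← h3, hadd s.1 s.2 x hx y hy hxy]
  obtain ⟨s, hs⟩ := (hg a).exists
  exact hf s.1 s.2 (hs.trans (DFunLike.congr_fun (hA G) a))

/-- Closing `{a}` under the small sets that force its elements to have zero image under all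
homomorphisms gives generators of a small subgroup with trivial dual. -/
theorem IsLCompact.sSup_small_trivialDual {μ : Cardinal.{u}} (h : IsLCompact ℵ₁ μ)
    (hμ : μ.IsRegular) (hμ' : ℵ₀ < μ) (hA : HasTrivialDual A) :
    sSup {B : AddSubgroup A | #B < μ ∧ HasTrivialDual B} = ⊤ := by
  classical
  refine eq_top_iff.2 fun a _ => ?_
  choose t ht hforce using fun a => hA.exists_forcesKernel hμ h a
  obtain ⟨s, has, hs, hst⟩ := exists_small_closed hμ hμ' t ht {a} (by simpa using hμ.nat_lt 1)
  suffices hdual : HasTrivialDual (AddSubgroup.closure s) from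
    (le_sSup (Set.mem_ofPred_eq ▸ ⟨mk_closure_lt hμ' hs, hdual⟩) :
      AddSubgroup.closure s ≤ sSup {B : AddSubgroup A | #B < μ ∧ HasTrivialDual B})
      (AddSubgroup.subset_closure (has rfl))
  intro g
  let f : A → ℤ := fun x => if hx : x ∈ AddSubgroup.closure s then g ⟨x, hx⟩ else 0
  have hf : ∀ x (hx : x ∈ AddSubgroup.closure s), f x = g ⟨x, hx⟩ := fun x hx => dif_pos hx
  have hker : ∀ b (hb : b ∈ s), g ⟨b, AddSubgroup.subset_closure hb⟩ = 0 := fun b hb => by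
    rw [← hf]
    refine hforce b f fun x hx y hy _ => ?_
    have hx' := AddSubgroup.subset_closure (hst b hb hx)
    have hy' := AddSubgroup.subset_closure (hst b hb hy)
    rw [hf x hx', hf y hy', hf _ (add_mem hx' hy'), ← map_add]
    rfl
  ext ⟨x, hx⟩
  induction hx using AddSubgroup.closure_induction with
  | mem x hx => exact hker x hx
  | zero => exact map_zero g
  | add x y hx hy ihx ihy =>
    exact (map_add g ⟨x, hx⟩ ⟨y, hy⟩).trans (by rw [ihx, ihy])
  | neg x hx ih => exact (map_neg g ⟨x, hx⟩).trans (by rw [ih])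

lemma HasTrivialDual.sup {B C : AddSubgroup A} (hB : HasTrivialDual B) (hC : HasTrivialDual C) :
    HasTrivialDual (B ⊔ C : AddSubgroup A) := by
  intro g
  have h1 := hB (g.comp (AddSubgroup.inclusion le_sup_left))
  have h2 := hC (g.comp (AddSubgroup.inclusion le_sup_right))
  ext ⟨x, hx⟩
  obtain ⟨b, hb, c, hc, rfl⟩ := AddSubgroup.mem_sup.1 hx
  have e := map_add g (AddSubgroup.inclusion le_sup_left ⟨b, hb⟩)
    (AddSubgroup.inclusion le_sup_right ⟨c, hc⟩)
  have e1 := DFunLike.congr_fun h1 ⟨b, hb⟩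
  have e2 := DFunLike.congr_fun h2 ⟨c, hc⟩
  rw [AddMonoidHom.comp_apply] at e1 e2
  rw [e1, e2] at e
  exact e.trans (add_zero 0)

/-- Small subgroups with trivial dual are directed, so their sum is their union. -/
lemma exists_small_trivialDual_mem {μ : Cardinal.{u}} (hμ : ℵ₀ ≤ μ)
    (h : sSup {B : AddSubgroup A | #B < μ ∧ HasTrivialDual B} = ⊤) (a : A) :
    ∃ B : AddSubgroup A, #B < μ ∧ HasTrivialDual B ∧ a ∈ B := by
  have ha : a ∈ sSup {B : AddSubgroup A | #B < μ ∧ HasTrivialDual B} := h ▸ AddSubgroup.mem_top a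
  have hbot : (⊥ : AddSubgroup A) ∈ {B : AddSubgroup A | #B < μ ∧ HasTrivialDual B} :=
    ⟨by simpa using one_lt_aleph0.trans_le hμ, fun g => by
      ext x; rw [Subsingleton.elim x 0, map_zero, map_zero]⟩
  have hdir : DirectedOn (· ≤ ·) {B : AddSubgroup A | #B < μ ∧ HasTrivialDual B} := by
    rintro B ⟨hB, hB'⟩ C ⟨hC, hC'⟩
    refine ⟨B ⊔ C, ⟨?_, hB'.sup hC'⟩, le_sup_left, le_sup_right⟩
    have hsurj : Function.Surjective fun p : B × C =>
        (⟨p.1 + p.2, AddSubgroup.add_mem_sup p.1.2 p.2.2⟩ : (B ⊔ C : AddSubgroup A)) := by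
      rintro ⟨x, hx⟩
      obtain ⟨b, hb, c, hc, rfl⟩ := AddSubgroup.mem_sup.1 hx
      exact ⟨(⟨b, hb⟩, ⟨c, hc⟩), rfl⟩
    refine (mk_le_of_surjective hsurj).trans_lt ?_
    rw [mk_prod, lift_id, lift_id]
    exact mul_lt_of_lt hμ hB hC
  obtain ⟨B, ⟨hB, hB'⟩, haB⟩ := (AddSubgroup.mem_sSup_of_directedOn ⟨_, hbot⟩ hdir).1 ha
  exact ⟨B, hB, hB', haB⟩

end Groups

/-! ### From sums of small subgroups to subsystems -/

section Subsystems

variable {X : Type u} {S : Set (HomEquation X)} {μ : Cardinal.{u}}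

/-- The equations needed to express the addition table of a small subgroup with trivial dual
containing the image of `x`, in the group presented by the system. -/
lemma exists_small_forcesZero (hμ : μ.IsRegular) (hμ' : ℵ₀ < μ)
    (h : ∀ (A : Type u) [AddCommGroup A], HasTrivialDual A → ∀ a : A,
      ∃ B : AddSubgroup A, #B < μ ∧ HasTrivialDual B ∧ a ∈ B)
    (hS : ¬ WeaklyNontriviallySolvable S ℤ) {x : X} (hx : x ∈ appearingVars S) :
    ∃ T ⊆ S, #T < μ ∧ ForcesZero T x := by
  classical
  have hS' := (not_weaklyNontriviallySolvable_iff.1 hS).2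
  -- Variables that do not appear in `S` are made zero, so that the group presented by the
  -- enlarged system has trivial dual.
  let R : Set (X →₀ ℤ) := S ∪ (fun y => Finsupp.single y 1) '' (appearingVars S)ᶜ
  let N : Submodule ℤ (X →₀ ℤ) := Submodule.span ℤ R
  have hA : HasTrivialDual ((X →₀ ℤ) ⧸ N) := by
    intro g
    have hlin : ∀ e : X →₀ ℤ, Finsupp.linearCombination ℤ
        (fun y => g (N.mkQ (Finsupp.single y 1))) e = g (N.mkQ e) := fun e =>
      DFunLike.congr_fun (f := Finsupp.linearCombination ℤ _)
        (g := g.toIntLinearMap ∘ₗ N.mkQ) (by ext; simp) e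
    have hR : ∀ e ∈ R, g (N.mkQ e) = 0 := fun e he => by
      rw [Submodule.mkQ_apply, (Submodule.Quotient.mk_eq_zero N).2 (Submodule.subset_span he),
        map_zero]
    have hzero : ∀ y, g (N.mkQ (Finsupp.single y 1)) = 0 := fun y => by
      by_cases hy : y ∈ appearingVars S
      · exact hS' y hy (fun y => g (N.mkQ (Finsupp.single y 1))) fun e he =>
          (hlin e).trans (hR e (Or.inl he))
      · exact hR _ (Or.inr ⟨y, hy, rfl⟩)
    ext q
    obtain ⟨e, rfl⟩ := N.mkQ_surjective q
    rw [← hlin]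
    simp only [hzero]
    simp [Finsupp.linearCombination_apply]
  obtain ⟨B, hB, hBdual, hxB⟩ := h _ hA (N.mkQ (Finsupp.single x 1))
  choose r hr using fun b : B => N.mkQ_surjective b
  have hfin : ∀ e ∈ N, ∃ T : Finset (X →₀ ℤ), (T : Set (X →₀ ℤ)) ⊆ R ∧ e ∈ Submodule.span ℤ T :=
    fun e he => Submodule.mem_span_finite_of_mem_span he
  have hker : ∀ {e}, N.mkQ e = 0 → e ∈ N := fun {e} he => (Submodule.Quotient.mk_eq_zero N).1 he
  obtain ⟨T₀, hT₀, hT₀x⟩ := hfin (r ⟨_, hxB⟩ - Finsupp.single x 1)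
    (hker (by rw [map_sub, hr, sub_self]))
  choose T₁ hT₁ hT₁r using fun p : B × B => hfin (r (p.1 + p.2) - (r p.1 + r p.2))
    (hker (by rw [map_sub, map_add, hr, hr, hr, AddSubgroup.coe_add, sub_self]))
  let T : Set (X →₀ ℤ) := T₀ ∪ ⋃ p, T₁ p
  have hfinset : ∀ F : Finset (X →₀ ℤ), #(F : Set (X →₀ ℤ)) < μ := fun F =>
    (lt_aleph0_of_finite _).trans hμ'
  have hT : #T < μ := by
    refine (mk_union_le _ _).trans_lt (add_lt_of_lt hμ.aleph0_le (hfinset _) ?_)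
    refine (card_iUnion_lt_iff_forall_of_isRegular hμ ?_).2 fun p => hfinset _
    rw [← mul_def]
    exact mul_lt_of_lt hμ.aleph0_le hB hB
  have hTR : T ⊆ R := Set.union_subset hT₀ (Set.iUnion_subset hT₁)
  refine ⟨T ∩ S, Set.inter_subset_right, (mk_le_mk_of_subset Set.inter_subset_left).trans_lt hT,
    fun f hf => ?_⟩
  let f' : X → ℤ := (appearingVars S).indicator f
  let L : (X →₀ ℤ) →ₗ[ℤ] ℤ := Finsupp.linearCombination ℤ f'
  have hL : ∀ e ∈ T, L e = 0 := fun e he => by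
    rcases hTR he with heS | ⟨y, hy, rfl⟩
    · refine Eq.trans (Finset.sum_congr rfl fun y hy => ?_) (hf e ⟨he, heS⟩)
      have : y ∈ appearingVars S := ⟨e, heS, hy⟩
      simp [f', this]
    · simpa [L, f'] using fun h => (hy h).elim
  have hspan : ∀ T' ⊆ T, ∀ e ∈ Submodule.span ℤ T', L e = 0 := fun T' hT' e he =>
    (Submodule.span_le (p := LinearMap.ker L)).2 (fun e he => hL e (hT' he)) he
  let g : B →+ ℤ := AddMonoidHom.mk' (fun b => L (r b)) fun b c => by
    have := hspan _ ((Set.subset_iUnion (fun p => (T₁ p : Set (X →₀ ℤ))) (b, c)).trans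
      Set.subset_union_right) _ (hT₁r (b, c))
    rw [map_sub, sub_eq_zero, map_add] at this
    exact this
  have h1 : L (r ⟨_, hxB⟩) = 0 := DFunLike.congr_fun (hBdual g) ⟨_, hxB⟩
  have h2 := hspan _ Set.subset_union_left _ hT₀x
  rw [map_sub, h1, zero_sub, neg_eq_zero] at h2
  simpa [L, f', hx] using h2

/-- Close `C` under adding, for every variable that appears, the few equations that force it
to vanish. -/
theorem exists_small_not_solvable (hμ : μ.IsRegular) (hμ' : ℵ₀ < μ)
    (h : ∀ (A : Type u) [AddCommGroup A], HasTrivialDual A → ∀ a : A,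
      ∃ B : AddSubgroup A, #B < μ ∧ HasTrivialDual B ∧ a ∈ B)
    (hS : ¬ WeaklyNontriviallySolvable S ℤ) {C : Set (HomEquation X)} (hCS : C ⊆ S)
    (hC : #C < μ) :
    ∃ T ⊆ S, C ⊆ T ∧ #T < μ ∧ ¬ WeaklyNontriviallySolvable T ℤ := by
  have hex : ∀ x : X, ∃ T ⊆ S, #T < μ ∧ (x ∈ appearingVars S → ForcesZero T x) := fun x => by
    by_cases hx : x ∈ appearingVars S
    · obtain ⟨T, hT, hc, hf⟩ := exists_small_forcesZero hμ hμ' h hS hx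
      exact ⟨T, hT, hc, fun _ => hf⟩
    · exact ⟨∅, Set.empty_subset _, by simpa using hμ.pos, fun h => (hx h).elim⟩
  choose t htS htc htf using hex
  obtain ⟨e, he⟩ := (not_weaklyNontriviallySolvable_iff.1 hS).1
  let u : HomEquation X → Set (HomEquation X) := fun e => ⋃ x ∈ (e.support : Set X), t x
  have hu : ∀ e, #(u e) < μ := fun e =>
    (card_biUnion_lt_iff_forall_of_isRegular (t := fun x _ => t x) hμ
      ((lt_aleph0_of_finite _).trans hμ')).2 fun x _ => htc x
  obtain ⟨s, hCs, hsc, hst⟩ := exists_small_closed hμ hμ' u hu (insert e C)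
    (mk_insert_le.trans_lt (add_lt_of_lt hμ.aleph0_le hC (by simpa using hμ.nat_lt 1)))
  refine ⟨s ∩ S, Set.inter_subset_right, fun c hc => ⟨hCs (Or.inr hc), hCS hc⟩,
    (mk_le_mk_of_subset Set.inter_subset_left).trans_lt hsc,
    not_weaklyNontriviallySolvable_iff.2 ⟨⟨e, hCs (Or.inl rfl), he⟩, ?_⟩⟩
  rintro x ⟨e', ⟨hes, heS⟩, hx⟩
  refine (htf x ⟨e', heS, hx⟩).mono (Set.subset_inter (subset_trans ?_ (hst e' hes)) (htS x))
  exact Set.subset_biUnion_of_mem (u := t) hx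

end Subsystems

/-! ### The equivalence -/

lemma IsLCompact.mono {ν μ μ' : Cardinal.{u}} (h : IsLCompact ν μ) (hμ : μ ≤ μ') :
    IsLCompact ν μ' := fun I F hne _ =>
  h I F hne (CardinalInterFilter.of_cardinalInterFilter_of_le F hμ)

theorem propositionp (κ : Cardinal.{u}) (hκ : Cardinal.aleph0 < κ) :
    List.TFAE [
      ∃ μ : Cardinal.{u}, μ.IsRegular ∧ μ ≤ κ ∧ IsLCompact (Cardinal.aleph 1) μ,
      ∃ μ : Cardinal.{u}, μ.IsRegular ∧ μ ≤ κ ∧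
        ∀ (A : Type u) [AddCommGroup A], HasTrivialDual A →
          sSup {B : AddSubgroup A | Cardinal.mk B < μ ∧ HasTrivialDual B} = ⊤,
      ∀ (X : Type u) (S : Set (HomEquation X)), S.Nonempty →
        ¬ WeaklyNontriviallySolvable S ℤ →
        ∀ C ⊆ S, Cardinal.mk C < κ →
          ∃ T ⊆ S, C ⊆ T ∧ Cardinal.mk T < κ ∧ ¬ WeaklyNontriviallySolvable T ℤ] := by
  tfae_have 1 → 2 := by
    rintro ⟨μ, hμ, hle, hc⟩
    -- Compactness passes to larger cardinals, so `μ = ℵ₀` may be replaced by `ℵ₁ ≤ κ`.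
    obtain rfl | hlt := hμ.aleph0_le.eq_or_lt
    · have h1 : ℵ₀ < ℵ₁ := aleph0_lt_aleph_one
      refine ⟨ℵ₁, isRegular_aleph_one, ?_, fun A _ hA =>
        (hc.mono h1.le).sSup_small_trivialDual isRegular_aleph_one h1 hA⟩
      rw [← succ_aleph0]
      exact Order.succ_le_of_lt hκ
    · exact ⟨μ, hμ, hle, fun A _ hA => hc.sSup_small_trivialDual hμ hlt hA⟩
  tfae_have 2 → 3 := by
    rintro ⟨μ, hμ, hle, h⟩ X S - hS C hCS hC
    -- A regular cardinal `ν` with `μ ≤ ν ≤ κ` and `#C < ν`, which exists even for singular `κ`.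
    obtain ⟨ν, hν, hν0, hμν, hνκ, hCν⟩ : ∃ ν : Cardinal.{u}, ν.IsRegular ∧ ℵ₀ < ν ∧ μ ≤ ν ∧
        ν ≤ κ ∧ #C < ν := by
      obtain rfl | hlt := hle.eq_or_lt
      · exact ⟨μ, hμ, hκ, le_rfl, le_rfl, hC⟩
      · have h0 : ℵ₀ ≤ max μ #C := hμ.aleph0_le.trans (le_max_left _ _)
        exact ⟨Order.succ (max μ #C), isRegular_succ h0, Order.lt_succ_of_le h0,
          (le_max_left _ _).trans (Order.le_succ _), Order.succ_le_of_lt (max_lt hlt hC),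
          Order.lt_succ_of_le (le_max_right _ _)⟩
    obtain ⟨T, hTS, hCT, hT, hn⟩ := exists_small_not_solvable hν hν0 (fun A _ hA a => by
      obtain ⟨B, hB, hB'⟩ := exists_small_trivialDual_mem hμ.aleph0_le (h A hA) a
      exact ⟨B, hB.trans_le hμν, hB'⟩) hS hCS hCν
    exact ⟨T, hTS, hCT, hT.trans_le hνκ, hn⟩
  tfae_have 3 → 1 := by
    intro h
    obtain hreg | hsing := isRegular_or_isSingular hκ.le
    · have hloc : LocallyReflects κ := fun X S hS e he => by
        obtain ⟨T, hTS, heT, hT⟩ := h X S ⟨e, he⟩ hS {e} (by simpa using he)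
          (by simpa using hreg.nat_lt 1)
        exact ⟨T, hTS, heT rfl, hT⟩
      exact ⟨κ, hreg, le_rfl, hloc.isLCompact⟩
    · obtain ⟨μ, hμ, hloc⟩ := exists_lt_locallyReflects hsing h
      refine ⟨Order.succ (max μ ℵ₀), isRegular_succ (le_max_right _ _),
        Order.succ_le_of_lt (max_lt hμ hκ),
        (hloc.mono ((le_max_left _ _).trans (Order.le_succ _))).isLCompact⟩
  tfae_finish
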